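/- A nondeterministic polynomial-time Turing machine (NPTM) is a nondeterministic Turing machine $N$ over the input alphabet $\{0,1\}$ for which there is a polynomial $p$ such that, on every input $x$, every computation path of $N$ on $x$ has at most $p(|x|)$ steps. Let $\#\mathrm{acc}_N(x)$ denote the number of accepting computation paths of $N$ on input $x$. Let $\mathrm{FewP}$ be the class of languages $L\subseteq\{0,1\}^*$ for which there are an NPTM $N$ and a polynomial $q$ such that, for every $x\in\{0,1\}^*$, $$x\notin L \implies \#\mathrm{acc}_N(x)=0, \qquad x\in L \implies 1\le \#\mathrm{acc}_N(x)\le q(|x|).$$ Let $\mathrm{EP}$ be the class of languages $L\subseteq\{0,1\}^*$ for which there is an NPTM $N$ such that, for every $x\in\{0,1\}^*$, $$x\notin L \implies \#\mathrm{acc}_N(x)=0, \qquad x\in L \implies \#\mathrm{acc}_N(x)\in\{2^i \mid i\in\mathbb{N}\},\quad \mathbb{N}=\{0,1,2,\ldots\}.$$ Then $\mathrm{FewP}\subseteq\mathrm{EP}$. -/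

import Mathlib

/-- A single instruction of a multitape Turing machine with state set `Q`, tape alphabet `Γ` and
set of tapes `K`: the new state, the symbol written on each tape, and the direction in which each
head then moves (`none` means that the head stays where it is). -/
structure TMMove (Q Γ K : Type) where
  state : Q
  write : K → Γ
  dir : K → Option Turing.Dir

/-- A nondeterministic multitape Turing machine with input alphabet `{0,1} = Bool`: finitely many
states, tape symbols and two-way infinite tapes, and a set-valued transition function. The blank
symbol is `default : Γ`; the input bits are two distinct nonblank tape symbols. -/
structure NTM where
  /-- states -/
  Q : Type
  /-- tape alphabet -/
  Γ : Type
  /-- index set of the tapes -/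
  K : Type
  [finQ : Finite Q]
  [finΓ : Finite Γ]
  [finK : Finite K]
  [blank : Inhabited Γ]
  /-- the tape symbols of the two input letters -/
  sym : Bool ↪ Γ
  sym_ne_blank : ∀ b, sym b ≠ default
  /-- the tape that holds the input at the start -/
  inputTape : K
  start : Q
  accept : Set Q
  /-- the instructions available in a given state with given scanned symbols -/
  δ : Q → (K → Γ) → Set (TMMove Q Γ K)

namespace NTM

attribute [instance] NTM.finQ NTM.finΓ NTM.finK NTM.blank

/-- A configuration: the state, and the contents of every tape relative to its head. -/
structure Cfg (N : NTM) where
  state : N.Q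
  tape : N.K → Turing.Tape N.Γ

/-- The initial configuration on input `x`: the head of the input tape scans the first letter of
`x`, and all other tapes are blank. -/
noncomputable def init (N : NTM) (x : List Bool) : N.Cfg where
  state := N.start
  tape := fun k =>
    open Classical in
    if k = N.inputTape then Turing.Tape.mk₁ (x.map N.sym) else Turing.Tape.mk₁ []

/-- The instructions that can be executed in the configuration `c`. -/
def moves (N : NTM) (c : N.Cfg) : Set (TMMove N.Q N.Γ N.K) :=
  N.δ c.state (fun k => (c.tape k).head)

/-- The result of executing the instruction `m` in the configuration `c`. -/
def next (N : NTM) (c : N.Cfg) (m : TMMove N.Q N.Γ N.K) : N.Cfg where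
  state := m.state
  tape := fun k =>
    match m.dir k with
    | none => (c.tape k).write (m.write k)
    | some d => ((c.tape k).write (m.write k)).move d

/-- `ms` is a sequence of instructions that can be executed one after the other from `c`. -/
def IsRun (N : NTM) : N.Cfg → List (TMMove N.Q N.Γ N.K) → Prop
  | _, [] => True
  | c, m :: ms => m ∈ N.moves c ∧ N.IsRun (N.next c m) ms

/-- The configuration reached from `c` by executing the instructions `ms`. -/
def final (N : NTM) (c : N.Cfg) (ms : List (TMMove N.Q N.Γ N.K)) : N.Cfg :=
  ms.foldl N.next c

/-- `ms` is an accepting computation path of `N` on input `x`: a run from the initial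
configuration that ends in a halting configuration (no instruction can be executed there)
whose state is accepting. -/
def IsAcceptingPath (N : NTM) (x : List Bool) (ms : List (TMMove N.Q N.Γ N.K)) : Prop :=
  N.IsRun (N.init x) ms ∧ N.moves (N.final (N.init x) ms) = ∅ ∧
    (N.final (N.init x) ms).state ∈ N.accept

/-- `#acc_N(x)`, the number of accepting computation paths of `N` on input `x`. -/
noncomputable def numAcc (N : NTM) (x : List Bool) : ℕ∞ :=
  {ms | N.IsAcceptingPath x ms}.encard

/-- `N` is a polynomial-time machine: some polynomial in the input length bounds the number of
steps of every computation of `N`, accepting or not. -/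
def PolyTime (N : NTM) : Prop :=
  ∃ p : Polynomial ℕ, ∀ (x : List Bool) (ms : List (TMMove N.Q N.Γ N.K)),
    N.IsRun (N.init x) ms → ms.length ≤ p.eval x.length

end NTM

/-- The class FewP: acceptance by at least one and at most polynomially many accepting paths,
rejection by none. -/
def FewP : Set (Language Bool) :=
  {L | ∃ N : NTM, N.PolyTime ∧ ∃ p : Polynomial ℕ, ∀ x : List Bool,
    (x ∉ L → N.numAcc x = 0) ∧
    (x ∈ L → 1 ≤ N.numAcc x ∧ N.numAcc x ≤ ((p.eval x.length : ℕ) : ℕ∞))}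

/-- The class EP: acceptance by a number of accepting paths that is a power of two,
rejection by none. -/
def EP : Set (Language Bool) :=
  {L | ∃ N : NTM, N.PolyTime ∧ ∀ x : List Bool,
    (x ∉ L → N.numAcc x = 0) ∧
    (x ∈ L → ∃ i : ℕ, N.numAcc x = ((2 ^ i : ℕ) : ℕ∞))}

/-!
Let `N` be a machine for a language in `FewP`, and let `f` be its number of accepting paths on
input `x`. A set with `f ≥ 1` elements has exactly `2 ^ (f - 1)` subsets of odd cardinality, and
the empty set has none. Hence it suffices to have a machine whose accepting paths correspond to the
sets of accepting paths of `N` that have odd cardinality.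

The machine `NTM.chain` guesses such a set in increasing order, with paths ordered
lexicographically. It simulates a path of `N` while it records on a history tape every instruction
executed and the symbols overwritten. When an accepting halting configuration of `N` is reached, it
may accept if the number of paths completed is odd, or it undoes the simulation by means of the
history, which restores the initial configuration exactly, and simulates a further path. The first
path is subject to no constraint. For each later one, the records of the previous path are still on
the history tape and are compared with the new path while they are overwritten, and the machine
stops and rejects unless the new path becomes larger at some point. Stale records beyond the end of
the current path do no harm: the accepting paths form a prefix-free set, so as long as the new path
agrees with the previous one, it has not run past the end of it.

No clock is needed. As the paths increase strictly, at most `f + 1` rounds are started, each of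
which takes time linear in the running time of `N`, and `f` is polynomially bounded because the
language is in `FewP`.

Both the number of accepting computations and the running time are tracked by `NTM.Counts`.
`NTM.Counts.sim` analyses the simulation of one path, `NTM.Counts.undo` and `NTM.Counts.turn` the
way back to the initial configuration, and `NTM.counts_chain` puts the rounds together by induction
on the number of accepting paths that are larger than the previous one.
-/

open Turing

/-! ### Orders, finiteness and finite sums -/

open Classical in
/-- An arbitrary linear order on the instructions of a machine. It orders the computation paths
lexicographically. -/
noncomputable instance TMMove.instLinearOrder (Q Γ K : Type) : LinearOrder (TMMove Q Γ K) :=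
  linearOrderOfSTO WellOrderingRel

instance Turing.Dir.instFinite : Finite Turing.Dir :=
  Finite.of_injective (fun d => decide (d = Turing.Dir.left)) (by
    rintro (_ | _) (_ | _) h <;> simp_all)

instance TMMove.instFinite (Q Γ K : Type) [Finite Q] [Finite Γ] [Finite K] :
    Finite (TMMove Q Γ K) :=
  Finite.of_injective (β := Q × (K → Γ) × (K → Option Turing.Dir))
    (fun m => (m.state, m.write, m.dir)) (by
      rintro ⟨q, w, d⟩ ⟨q', w', d'⟩ h
      simpa using h)

theorem finsum_mem_iUnion_cons {α M : Type*} [AddCommMonoid M] {s : Set α} {t : α → Set (List α)}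
    (hs : s.Finite) (ht : ∀ m ∈ s, (t m).Finite) (G : List α → M) :
    ∑ᶠ τ ∈ ⋃ m ∈ s, (m :: ·) '' t m, G τ = ∑ᶠ m ∈ s, ∑ᶠ τ ∈ t m, G (m :: τ) := by
  rw [finsum_mem_biUnion _ hs fun m hm => (ht m hm).image _]
  · refine finsum_mem_congr rfl fun m _ => ?_
    exact finsum_mem_image (List.cons_injective.injOn)
  · intro a _ b _ hab
    refine Set.disjoint_left.2 ?_
    rintro _ ⟨τ, _, rfl⟩ ⟨τ', _, h⟩
    exact hab (List.cons.inj h).1.symm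

/-- In a finite linear order, the numbers of elements above the various elements of a `j`-element
set are `0, …, j - 1`, each attained once. -/
theorem Finset.sum_card_filter_lt {α : Type*} [LinearOrder α] (s : Finset α) (f : ℕ → ℕ) :
    ∑ a ∈ s, f (s.filter (a < ·)).card = ∑ i ∈ Finset.range s.card, f i := by
  induction s using Finset.induction_on_min with
  | empty => simp
  | insert a s ha ih =>
    have has : a ∉ s := fun h => lt_irrefl _ (ha a h)
    rw [Finset.sum_insert has, Finset.card_insert_of_notMem has, Finset.sum_range_succ, ← ih,
      add_comm]
    congr 1
    · refine Finset.sum_congr rfl fun b hb => ?_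
      rw [Finset.filter_insert, if_neg (ha b hb).not_gt]
    · rw [Finset.filter_insert, if_neg (lt_irrefl a), Finset.filter_true_of_mem ha]

/-! ### Counting accepting computations step by step -/

namespace NTM

variable {N : NTM}

/-- The accepting computations that start in the configuration `c`. -/
def accRuns (N : NTM) (c : N.Cfg) : Set (List (TMMove N.Q N.Γ N.K)) :=
  {ms | N.IsRun c ms ∧ N.moves (N.final c ms) = ∅ ∧ (N.final c ms).state ∈ N.accept}

theorem nil_mem_accRuns {c : N.Cfg} :
    [] ∈ N.accRuns c ↔ N.moves c = ∅ ∧ c.state ∈ N.accept := by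
  simp [accRuns, IsRun, final]

theorem cons_mem_accRuns {c : N.Cfg} {m : TMMove N.Q N.Γ N.K} {ms} :
    m :: ms ∈ N.accRuns c ↔ m ∈ N.moves c ∧ ms ∈ N.accRuns (N.next c m) := by
  simp [accRuns, IsRun, final, and_assoc]

theorem finite_accRuns {c : N.Cfg} {T : ℕ} (h : ∀ ms, N.IsRun c ms → ms.length ≤ T) :
    (N.accRuns c).Finite :=
  (List.finite_length_le _ T).subset fun ms hms => h ms hms.1

theorem accRuns_eq_iUnion {c : N.Cfg} (h : (N.moves c).Nonempty) :
    N.accRuns c = ⋃ m ∈ N.moves c, (m :: ·) '' N.accRuns (N.next c m) := by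
  ext (_ | ⟨m, ms⟩)
  · simp [nil_mem_accRuns, h.ne_empty]
  · simp only [cons_mem_accRuns, Set.mem_iUnion, Set.mem_image, List.cons.injEq, exists_prop]
    constructor
    · rintro ⟨h1, h2⟩
      exact ⟨m, h1, ms, h2, rfl, rfl⟩
    · rintro ⟨_, h1, _, h2, rfl, rfl⟩
      exact ⟨h1, h2⟩

/-- From the configuration `c` there are exactly `n` accepting computations, and every
computation has at most `T` steps. -/
def Counts (N : NTM) (c : N.Cfg) (n T : ℕ) : Prop :=
  (N.accRuns c).ncard = n ∧ ∀ ms, N.IsRun c ms → ms.length ≤ T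

theorem Counts.mono {c : N.Cfg} {n T T' : ℕ} (h : N.Counts c n T) (hT : T ≤ T') :
    N.Counts c n T' :=
  ⟨h.1, fun ms hms => (h.2 ms hms).trans hT⟩

theorem length_le_of_moves_eq_empty {c : N.Cfg} (h : N.moves c = ∅) (T : ℕ) :
    ∀ ms, N.IsRun c ms → ms.length ≤ T := by
  rintro (_ | ⟨m, ms⟩) hms
  · simp
  · exact absurd hms.1 (by simp [h])

theorem eq_nil_of_mem_accRuns {c : N.Cfg} (h : N.moves c = ∅) {ms} (hms : ms ∈ N.accRuns c) :
    ms = [] :=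
  List.length_eq_zero_iff.1 (Nat.le_zero.1 (length_le_of_moves_eq_empty h 0 ms hms.1))

theorem Counts.halt_reject {c : N.Cfg} (h : N.moves c = ∅) (hc : c.state ∉ N.accept) (T : ℕ) :
    N.Counts c 0 T := by
  refine ⟨?_, length_le_of_moves_eq_empty h T⟩
  have : N.accRuns c = ∅ := Set.eq_empty_of_forall_notMem fun ms hms => by
    obtain rfl := eq_nil_of_mem_accRuns h hms
    exact hc hms.2.2
  simp [this]

theorem Counts.halt_accept {c : N.Cfg} (h : N.moves c = ∅) (hc : c.state ∈ N.accept) (T : ℕ) :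
    N.Counts c 1 T := by
  refine ⟨?_, length_le_of_moves_eq_empty h T⟩
  have : N.accRuns c = {[]} := Set.eq_singleton_iff_unique_mem.2
    ⟨nil_mem_accRuns.2 ⟨h, hc⟩, fun ms hms => eq_nil_of_mem_accRuns h hms⟩
  simp [this]

theorem Counts.step {c : N.Cfg} {T : ℕ} {n : TMMove N.Q N.Γ N.K → ℕ} (hne : (N.moves c).Nonempty)
    (h : ∀ m ∈ N.moves c, N.Counts (N.next c m) (n m) T) :
    N.Counts c (∑ᶠ m ∈ N.moves c, n m) (T + 1) := by
  constructor
  · rw [accRuns_eq_iUnion hne, ← finsum_one,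
      finsum_mem_iUnion_cons (Set.toFinite _) fun m hm => finite_accRuns (h m hm).2]
    exact finsum_mem_congr rfl fun m hm => by rw [finsum_one, (h m hm).1]
  · rintro (_ | ⟨m, ms⟩) hms
    · simp
    · simpa using (h m hms.1).2 ms hms.2

theorem Counts.step_image {α : Type*} {c : N.Cfg} {T : ℕ} {f : α → TMMove N.Q N.Γ N.K}
    {s : Set α} {n : α → ℕ} (hf : Function.Injective f) (hs : s.Nonempty)
    (hm : N.moves c = f '' s) (h : ∀ a ∈ s, N.Counts (N.next c (f a)) (n a) T) :
    N.Counts c (∑ᶠ a ∈ s, n a) (T + 1) := by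
  have := Counts.step (c := c) (n := Function.extend f n 0) (T := T) (hm ▸ hs.image f) (by
    rw [hm]
    rintro _ ⟨a, ha, rfl⟩
    rw [hf.extend_apply]
    exact h a ha)
  rw [hm, finsum_mem_image hf.injOn] at this
  simpa only [hf.extend_apply] using this

theorem Counts.step_pair {c : N.Cfg} {n n' T : ℕ} {m m' : TMMove N.Q N.Γ N.K} (hne : m ≠ m')
    (hm : N.moves c = {m, m'}) (h : N.Counts (N.next c m) n T) (h' : N.Counts (N.next c m') n' T) :
    N.Counts c (n + n') (T + 1) := by
  classical
  have := Counts.step (c := c) (n := fun a => if a = m then n else n') (T := T) (by simp [hm])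
    (by simpa [hm, hne.symm] using ⟨h, h'⟩)
  rw [hm, finsum_mem_pair hne] at this
  simpa [hne.symm] using this

theorem Counts.step_singleton {c : N.Cfg} {n T : ℕ} {m : TMMove N.Q N.Γ N.K}
    (hm : N.moves c = {m}) (h : N.Counts (N.next c m) n T) : N.Counts c n (T + 1) := by
  have := Counts.step (c := c) (n := fun _ => n) (T := T) (by simp [hm]) (by simpa [hm] using h)
  simpa [hm] using this

end NTM

/-! ### The chain machine -/

/-- The states of the machine that guesses increasing sequences of accepting paths of a machine
with state set `Q`. In each of them, the Boolean `b` is the parity of the number of paths that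
have been completed. -/
inductive ChainState (Q : Type)
  /-- The original machine is simulated in state `q`. If `tight` holds, the current path agrees so
  far with the previous one, and otherwise it is known to be larger. -/
  | sim (b tight : Bool) (q : Q)
  /-- The head movements of the last simulated instruction not yet undone are to be reverted. -/
  | unmove (b : Bool)
  /-- The symbols overwritten by that instruction are to be restored. -/
  | unwrite (b : Bool)
  /-- The sequence of paths is complete. -/
  | done

instance ChainState.instFinite (Q : Type) [Finite Q] : Finite (ChainState Q) :=
  Finite.of_injective (β := (Bool × Bool × Q) ⊕ Bool ⊕ Option Bool)
    (fun
      | .sim b t q => .inl (b, t, q)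
      | .unmove b => .inr (.inl b)
      | .unwrite b => .inr (.inr (some b))
      | .done => .inr (.inr none)) (by
      rintro (_ | _ | _ | _) (_ | _ | _ | _) h <;> simp_all)

/-- The opposite direction. -/
def Turing.Dir.flip : Dir → Dir
  | .left => .right
  | .right => .left

theorem Turing.Tape.move_flip {Γ : Type*} [Inhabited Γ] (T : Tape Γ) (d : Dir) :
    (T.move d).move d.flip = T := by
  cases d <;> simp [Dir.flip]

theorem Turing.Tape.write_write_head {Γ : Type*} [Inhabited Γ] (T : Tape Γ) (a : Γ) :
    (T.write a).write T.head = T := rfl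

namespace NTM

variable (N : NTM)

/-- A record of one step of `N`: the instruction executed and the symbols it overwrote. -/
abbrev Cell : Type := TMMove N.Q N.Γ N.K × (N.K → N.Γ)

/-- The tape alphabet of the chain machine: a symbol of `N` together with a possible history
record. The work tapes use only the first component and the history tape only the second. -/
abbrev ChainSym : Type := N.Γ × Option N.Cell

/-- A symbol of `N` as a symbol of the chain machine. -/
def workSym : PointedMap N.Γ N.ChainSym := ⟨fun g => (g, none), rfl⟩

/-- A history record as a symbol of the chain machine. -/
def histSym (h : N.Cell) : N.ChainSym := (default, some h)

variable {N} in
/-- Simulate the instruction `m` of `N`, executed when the symbols `s` are scanned, and put it on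
record. The history tape has index `none`. -/
def recordMove (b tight : Bool) (s : N.K → N.Γ) (m : TMMove N.Q N.Γ N.K) :
    TMMove (ChainState N.Q) N.ChainSym (Option N.K) where
  state := .sim b tight m.state
  write := fun k => k.elim (N.histSym (m, s)) fun k => N.workSym (m.write k)
  dir := fun k => k.elim (some .right) m.dir

variable {N} in
/-- Go to state `q`, leave the tapes as they are with the symbols `a` scanned, and move the history
head to `d`. -/
def histMove (a : Option N.K → N.ChainSym) (q : ChainState N.Q) (d : Option Dir) :
    TMMove (ChainState N.Q) N.ChainSym (Option N.K) where
  state := q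
  write := a
  dir := fun k => k.elim d fun _ => none

variable {N} in
/-- Revert the head movements of the recorded instruction `h`. -/
def unmoveMove (a : Option N.K → N.ChainSym) (b : Bool) (h : N.Cell) :
    TMMove (ChainState N.Q) N.ChainSym (Option N.K) where
  state := .unwrite b
  write := a
  dir := fun k => k.elim none fun k => (h.1.dir k).map Dir.flip

variable {N} in
/-- Restore the symbols overwritten by the recorded instruction `h`, and go one step back in the
history. -/
def unwriteMove (a : Option N.K → N.ChainSym) (b : Bool) (h : N.Cell) :
    TMMove (ChainState N.Q) N.ChainSym (Option N.K) where
  state := .unmove b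
  write := fun k => k.elim (a none) fun k => N.workSym (h.2 k)
  dir := fun k => k.elim (some .left) fun _ => none

variable {N} in
/-- Whether the instruction `m` keeps the current path equal to the previous one, if it has been
equal so far and `prev` is the next record of the previous path. -/
noncomputable def staysTight (tight : Bool) (prev : Option N.Cell) (m : TMMove N.Q N.Γ N.K) :
    Bool :=
  tight && decide (prev.map Prod.fst = some m)

/-- The transition function of the chain machine. -/
noncomputable def chainδ : ChainState N.Q → (Option N.K → N.ChainSym) →
    Set (TMMove (ChainState N.Q) N.ChainSym (Option N.K))
  | .sim b tight q, a =>
    let s := fun k => (a (some k)).1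
    let prev := (a none).2
    (fun m => recordMove b (staysTight tight prev m) s m) ''
      {m ∈ N.δ q s | tight → ∀ h ∈ prev, h.1 ≤ m} ∪
    {m | (N.δ q s = ∅ ∧ q ∈ N.accept ∧ tight = false) ∧
      (m = histMove a (.unmove !b) (some .left) ∨ b = false ∧ m = histMove a .done none)}
  | .unmove b, a =>
    match (a none).2 with
    | some h => {unmoveMove a b h}
    | none => {histMove a (.sim b true N.start) (some .right)}
  | .unwrite b, a =>
    match (a none).2 with
    | some h => {unwriteMove a b h}
    -- The state `unwrite` is entered only with the history head on a record.
    | none => ∅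
  | .done, _ => ∅

/-- The chain machine of `N`. It guesses an increasing sequence of accepting paths of `N` of odd
length. The paths are simulated one after the other; after each of them the simulation is run
backwards to recover the initial configuration. -/
noncomputable def chain : NTM where
  Q := ChainState N.Q
  Γ := N.ChainSym
  K := Option N.K
  sym := N.sym.trans ⟨fun g => N.workSym g, fun _ _ h => (Prod.mk.inj h).1⟩
  sym_ne_blank := fun b h => N.sym_ne_blank b (Prod.mk.inj h).1
  inputTape := some N.inputTape
  start := .sim false false N.start
  accept := {.done}
  δ := N.chainδ

variable {N}

/-- The symbols scanned in a configuration. -/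
def scanned (c : N.Cfg) : N.K → N.Γ := fun k => (c.tape k).head

/-- The configuration of the chain machine with work tapes `T` and history tape `H`. -/
noncomputable def chainCfg (q : ChainState N.Q) (T : N.K → Tape N.Γ) (H : Tape N.ChainSym) :
    N.chain.Cfg where
  state := q
  tape := fun k => k.elim H fun k => (T k).map N.workSym

/-- The symbols scanned by the chain machine with work tapes `T` and history tape `H`. -/
def chainScanned (T : N.K → Tape N.Γ) (H : Tape N.ChainSym) : Option N.K → N.ChainSym :=
  fun k => k.elim H.head fun k => N.workSym (T k).head

theorem moves_chainCfg (q : ChainState N.Q) (T : N.K → Tape N.Γ) (H : Tape N.ChainSym) :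
    N.chain.moves (chainCfg q T H) =
      N.chainδ q (chainScanned T H) := by
  refine congrArg (N.chainδ q) (funext fun k => ?_)
  cases k with
  | none => rfl
  | some k => exact Tape.map_fst _ _

/-! ### Single steps of the chain machine -/

theorem moves_unmove {b : Bool} {T : N.K → Tape N.Γ} {H : Tape N.ChainSym} {h : N.Cell}
    (hH : H.head = N.histSym h) :
    N.chain.moves (chainCfg (.unmove b) T H) = {unmoveMove (chainScanned T H) b h} := by
  have : (chainScanned T H none).2 = some h := congrArg Prod.snd hH
  rw [moves_chainCfg, chainδ, this]
  rfl

theorem moves_unwrite {b : Bool} {T : N.K → Tape N.Γ} {H : Tape N.ChainSym} {h : N.Cell}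
    (hH : H.head = N.histSym h) :
    N.chain.moves (chainCfg (.unwrite b) T H) = {unwriteMove (chainScanned T H) b h} := by
  have : (chainScanned T H none).2 = some h := congrArg Prod.snd hH
  rw [moves_chainCfg, chainδ, this]
  rfl

/-- The blank cell at the left end of the history signals that everything has been undone. -/
theorem moves_unmove_of_blank {b : Bool} {T : N.K → Tape N.Γ} {H : Tape N.ChainSym}
    (hH : H.head = default) :
    N.chain.moves (chainCfg (.unmove b) T H) =
      {histMove (chainScanned T H) (.sim b true N.start) (some .right)} := by
  have : (chainScanned T H none).2 = none := congrArg Prod.snd hH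
  rw [moves_chainCfg, chainδ, this]
  rfl

theorem moves_sim {b tight : Bool} {c : N.Cfg} {H : Tape N.ChainSym} :
    N.chain.moves (chainCfg (.sim b tight c.state) c.tape H) =
      (fun m => recordMove b (staysTight tight H.head.2 m) (scanned c) m) ''
        {m ∈ N.moves c | tight → ∀ h ∈ H.head.2, h.1 ≤ m} ∪
      {m | (N.moves c = ∅ ∧ c.state ∈ N.accept ∧ tight = false) ∧
        (m = histMove (chainScanned c.tape H) (.unmove !b) (some .left) ∨
          b = false ∧ m = histMove (chainScanned c.tape H) .done none)} := by
  rw [moves_chainCfg]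
  rfl

theorem next_eq_chainCfg {c : N.chain.Cfg}
    {m : TMMove (ChainState N.Q) N.ChainSym (Option N.K)} {q : ChainState N.Q}
    {T : N.K → Tape N.Γ} {H : Tape N.ChainSym} (hq : m.state = q)
    (hH : (N.chain.next c m).tape none = H)
    (hT : ∀ k, (N.chain.next c m).tape (some k) = (T k).map N.workSym) :
    N.chain.next c m = chainCfg q T H := by
  have h : (N.chain.next c m).tape = (chainCfg q T H).tape := by
    funext k
    cases k with
    | none => exact hH
    | some k => exact hT k
  calc N.chain.next c m = ⟨m.state, (N.chain.next c m).tape⟩ := rfl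
    _ = _ := by rw [h, hq]; rfl

theorem init_chain (x : List Bool) :
    N.chain.init x =
      chainCfg (.sim false false N.start) (N.init x).tape
        (.mk' (ListBlank.mk []) (ListBlank.mk [])) := by
  have h : (N.chain.init x).tape = (chainCfg (.sim false false N.start) (N.init x).tape
      (.mk' (ListBlank.mk []) (ListBlank.mk []))).tape := by
    funext k
    cases k with
    | none => exact if_neg (by rintro ⟨⟩)
    | some k =>
      by_cases hk : k = N.inputTape
      · have h2 : (N.init x).tape k = .mk₁ (x.map N.sym) := if_pos hk
        have h3 : (Tape.map N.workSym ((N.init x).tape k)) = .mk₁ (x.map N.chain.sym) := by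
          rw [h2, Tape.map_mk₁, List.map_map]
          rfl
        exact (if_pos (congrArg some hk)).trans h3.symm
      · have h2 : (N.init x).tape k = .mk₁ [] := if_neg hk
        have h3 : (Tape.map N.workSym ((N.init x).tape k)) = .mk₁ [] := by
          rw [h2, Tape.map_mk₁]
          rfl
        exact (if_neg fun h => hk (Option.some.inj h)).trans h3.symm
  calc N.chain.init x = ⟨.sim false false N.start, (N.chain.init x).tape⟩ := rfl
    _ = _ := by rw [h]; rfl

theorem next_tape (c : N.Cfg) (m : TMMove N.Q N.Γ N.K) (k : N.K) :
    (N.next c m).tape k =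
      match m.dir k with
      | none => (c.tape k).write (m.write k)
      | some d => ((c.tape k).write (m.write k)).move d := rfl

theorem next_recordMove (b t : Bool) (q : ChainState N.Q) (c : N.Cfg) (L R : ListBlank N.ChainSym)
    (m : TMMove N.Q N.Γ N.K) :
    N.chain.next (chainCfg q c.tape (.mk' L R)) (recordMove b t (scanned c) m) =
      chainCfg (.sim b t m.state) (N.next c m).tape
        (.mk' (L.cons (N.histSym (m, scanned c))) R.tail) := by
  refine next_eq_chainCfg rfl ?_ fun k => ?_
  · change ((Tape.mk' L R).write _).move .right = _
    simp [recordMove]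
  · change (match m.dir k with
      | none => ((c.tape k).map N.workSym).write (N.workSym (m.write k))
      | some d => (((c.tape k).map N.workSym).write (N.workSym (m.write k))).move d) = _
    rw [next_tape]
    cases m.dir k <;> simp [Tape.map_move]

theorem next_histMove (q q' : ChainState N.Q) (T : N.K → Tape N.Γ) (H : Tape N.ChainSym)
    (d : Dir) :
    N.chain.next (chainCfg q T H)
      (histMove (chainScanned T H) q' (some d)) =
      chainCfg q' T (H.move d) := by
  refine next_eq_chainCfg rfl ?_ fun k => ?_
  · change (H.write H.head).move d = _
    simp
  · change ((T k).map N.workSym).write (N.workSym (T k).head) = _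
    rw [← Tape.map_write, Tape.write_self]

theorem next_unmoveMove (q : ChainState N.Q) (b : Bool) (c : N.Cfg) (m : TMMove N.Q N.Γ N.K)
    (s : N.K → N.Γ) (H : Tape N.ChainSym) :
    N.chain.next (chainCfg q (N.next c m).tape H)
      (unmoveMove (chainScanned (N.next c m).tape H) b (m, s)) =
      chainCfg (.unwrite b) (fun k => (c.tape k).write (m.write k)) H := by
  refine next_eq_chainCfg rfl (Tape.write_self H) fun k => ?_
  change (match (m.dir k).map Dir.flip with
    | none => (((N.next c m).tape k).map N.workSym).write (N.workSym ((N.next c m).tape k).head)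
    | some d => ((((N.next c m).tape k).map N.workSym).write
      (N.workSym ((N.next c m).tape k).head)).move d) = _
  rw [← Tape.map_write, Tape.write_self, next_tape]
  cases m.dir k with
  | none => rfl
  | some d => simp [← Tape.map_move, Tape.move_flip]

theorem next_unwriteMove (q : ChainState N.Q) (b : Bool) (c : N.Cfg) (m : TMMove N.Q N.Γ N.K)
    (H : Tape N.ChainSym) :
    N.chain.next (chainCfg q (fun k => (c.tape k).write (m.write k)) H)
      (unwriteMove (chainScanned (fun k => (c.tape k).write (m.write k)) H) b (m, scanned c)) =
      chainCfg (.unmove b) c.tape (H.move .left) := by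
  refine next_eq_chainCfg rfl ?_ fun k => ?_
  · change (H.write H.head).move .left = _
    simp
  · change (((c.tape k).write (m.write k)).map N.workSym).write (N.workSym (c.tape k).head) = _
    rw [← Tape.map_write, Tape.write_write_head]

/-! ### Undoing a simulation -/

/-- The history records of the steps in the computation `ms` from `c`. -/
def records (c : N.Cfg) : List (TMMove N.Q N.Γ N.K) → List N.ChainSym
  | [] => []
  | m :: ms => N.histSym (m, scanned c) :: records (N.next c m) ms

/-- Running the simulation backwards: if the records of `ms` are on the history tape just left of
the head, the work tapes are brought back to their state before `ms`. -/
theorem Counts.undo {b : Bool} {n T : ℕ} {ms : List (TMMove N.Q N.Γ N.K)} {c : N.Cfg}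
    {L R : ListBlank N.ChainSym}
    (h : N.chain.Counts
      (chainCfg (.unmove b) c.tape ((Tape.mk' L (R.append (records c ms))).move .left)) n T) :
    N.chain.Counts (chainCfg (.unmove b) (N.final c ms).tape
      ((Tape.mk' (L.append (records c ms).reverse) R).move .left)) n (T + 2 * ms.length) := by
  induction ms generalizing c L T with
  | nil => exact h
  | cons m ms ih =>
    have key : N.chain.Counts (chainCfg (.unmove b) (N.next c m).tape
        ((Tape.mk' (L.cons (N.histSym (m, scanned c)))
          (R.append (records (N.next c m) ms))).move .left)) n (T + 2) := by
      rw [Tape.move_left_mk', ListBlank.tail_cons, ListBlank.head_cons]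
      refine Counts.step_singleton (moves_unmove (ListBlank.head_cons _ _)) (T := T + 1) ?_
      rw [next_unmoveMove]
      refine Counts.step_singleton (moves_unwrite (ListBlank.head_cons _ _)) ?_
      rw [next_unwriteMove]
      exact h
    have := ih key
    rw [records, List.reverse_cons, ListBlank.append_assoc, List.length_cons, mul_add, mul_one,
      add_comm (2 * _), ← add_assoc]
    exact this

end NTM

/-! ### One round: a path larger than the previous one -/

namespace NTM

variable {N : NTM}

/-- The computation `τ` is larger than the previous one, if there is a previous one. -/
def Above (o : Option (List (TMMove N.Q N.Γ N.K))) (τ : List (TMMove N.Q N.Γ N.K)) : Prop :=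
  ∀ ρ ∈ o, ρ < τ

/-- The history tape, from the head to the right, starts with the records of the previous computation `o`,
an accepting one, if there is a previous one. -/
def Remembers (c : N.Cfg) (o : Option (List (TMMove N.Q N.Γ N.K))) (R : ListBlank N.ChainSym) :
    Prop :=
  ∀ ρ ∈ o, ρ ∈ N.accRuns c ∧ ∃ R', R = ListBlank.append (records c ρ) R'

/-- What remains of the previous computation after the allowed instruction `m`: it ceases to be a
constraint as soon as the current computation exceeds it. -/
noncomputable def constraintAfter (m : TMMove N.Q N.Γ N.K) :
    Option (List (TMMove N.Q N.Γ N.K)) → Option (List (TMMove N.Q N.Γ N.K))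
  | some (m₀ :: ρ) => if m₀ = m then some ρ else none
  | _ => none

/-- The instructions that do not make the computation smaller than the previous one. -/
def allowed (c : N.Cfg) (o : Option (List (TMMove N.Q N.Γ N.K))) : Set (TMMove N.Q N.Γ N.K) :=
  {m ∈ N.moves c | ∀ ρ ∈ o, ∀ m₀ ∈ ρ.head?, m₀ ≤ m}

theorem accRuns_above_eq_iUnion {c : N.Cfg} {o : Option (List (TMMove N.Q N.Γ N.K))}
    (h : (N.moves c).Nonempty) (ho : ∀ ρ ∈ o, ρ ∈ N.accRuns c) :
    {τ ∈ N.accRuns c | Above o τ} = ⋃ m ∈ allowed c o,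
      (m :: ·) '' {τ ∈ N.accRuns (N.next c m) | Above (constraintAfter m o) τ} := by
  have key : ∀ m τ, (m :: τ ∈ N.accRuns c ∧ Above o (m :: τ)) ↔ m ∈ allowed c o ∧
      τ ∈ N.accRuns (N.next c m) ∧ Above (constraintAfter m o) τ := by
    intro m τ
    rw [cons_mem_accRuns]
    match o with
    | none => simp [Above, allowed, constraintAfter]
    | some [] => exact absurd (nil_mem_accRuns.1 (ho _ rfl)).1 h.ne_empty
    | some (m₀ :: ρ) =>
      by_cases hm : m₀ = m
      · subst hm
        simp [Above, allowed, constraintAfter, and_assoc]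
      · have hlt : m₀ < m ↔ m₀ ≤ m := by simp [lt_iff_le_and_ne, hm]
        simp [Above, allowed, constraintAfter, hm, List.cons_lt_cons_iff, hlt]
        tauto
  ext (_ | ⟨m, τ⟩)
  · simp [nil_mem_accRuns, h.ne_empty]
  · rw [Set.mem_ofPred_eq, key]
    simp only [Set.mem_iUnion, Set.mem_image, List.cons.injEq, exists_prop]
    constructor
    · rintro ⟨h1, h2⟩
      exact ⟨m, h1, τ, h2, rfl, rfl⟩
    · rintro ⟨_, h1, _, h2, rfl, rfl⟩
      exact ⟨h1, h2⟩

theorem recordMove_injective (b : Bool) (f : TMMove N.Q N.Γ N.K → Bool) (s : N.K → N.Γ) :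
    Function.Injective fun m => recordMove b (f m) s m := by
  intro m m' h
  have := congrFun (congrArg TMMove.write h) none
  simpa [recordMove, histSym] using this

/-- In a configuration where `N` can move, the chain machine simulates exactly the allowed
instructions, and it remains to compare the rest of the computation with the rest of the previous
one. -/
theorem moves_sim_of_remembers {b : Bool} {c : N.Cfg} {o : Option (List (TMMove N.Q N.Γ N.K))}
    {L R : ListBlank N.ChainSym} (h : (N.moves c).Nonempty) (hR : Remembers c o R) :
    N.chain.moves (chainCfg (.sim b o.isSome c.state) c.tape (.mk' L R)) =
      (fun m => recordMove b (constraintAfter m o).isSome (scanned c) m) '' allowed c o := by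
  rw [moves_sim, Set.union_eq_left.2 fun m hm => absurd hm.1.1 h.ne_empty]
  match o with
  | none =>
    simp [allowed, constraintAfter, staysTight]
    rfl
  | some [] => exact absurd (nil_mem_accRuns.1 (hR _ rfl).1).1 h.ne_empty
  | some (m₀ :: ρ) =>
    obtain ⟨-, R', rfl⟩ := hR _ rfl
    have h1 : ∀ m, staysTight true (some (m₀, scanned c)) m =
        (constraintAfter m (some (m₀ :: ρ))).isSome := by
      intro m
      by_cases hm : m₀ = m <;> simp [staysTight, constraintAfter, hm]
    simp [records, allowed, histSym, h1]
    rfl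

theorem Remembers.tail {c : N.Cfg} {o : Option (List (TMMove N.Q N.Γ N.K))}
    {R : ListBlank N.ChainSym} (hR : Remembers c o R) (m : TMMove N.Q N.Γ N.K) :
    Remembers (N.next c m) (constraintAfter m o) R.tail := by
  match o with
  | none => simp [Remembers, constraintAfter]
  | some [] => simp [Remembers, constraintAfter]
  | some (m₀ :: ρ) =>
    by_cases hm : m₀ = m
    · subst hm
      obtain ⟨h, R', rfl⟩ := hR _ rfl
      simp only [Remembers, constraintAfter, if_true, Option.mem_some_iff, forall_eq']
      exact ⟨(cons_mem_accRuns.1 h).2, R', by simp [records]⟩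
    · simp [Remembers, constraintAfter, hm]

/-- One round of the chain machine, from the configuration `c` of `N`: if an accepting computation
`τ` from `c` has `G τ` accepting continuations once its simulation is complete, then the total
number is the sum over those `τ` that exceed the previous computation. -/
theorem Counts.sim {b : Bool} {T t : ℕ} {c : N.Cfg} {o : Option (List (TMMove N.Q N.Γ N.K))}
    {L R : ListBlank N.ChainSym} {G : List (TMMove N.Q N.Γ N.K) → ℕ}
    (ht : ∀ ms, N.IsRun c ms → ms.length ≤ t) (hR : Remembers c o R)
    (hG : ∀ τ ∈ N.accRuns c, Above o τ → ∀ R', N.chain.Counts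
      (chainCfg (.sim b false (N.final c τ).state) (N.final c τ).tape
        (.mk' (L.append (records c τ).reverse) R')) (G τ) T) :
    N.chain.Counts (chainCfg (.sim b o.isSome c.state) c.tape (.mk' L R))
      (∑ᶠ τ ∈ {τ ∈ N.accRuns c | Above o τ}, G τ) (T + t) := by
  induction t using Nat.strong_induction_on generalizing c o L R G with | _ t ih => ?_
  rcases (N.moves c).eq_empty_or_nonempty with hc | hc
  · have hmoves : o.isSome = true ∨ c.state ∉ N.accept →
        N.chain.moves (chainCfg (.sim b o.isSome c.state) c.tape (.mk' L R)) = ∅ := by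
      intro h
      rw [moves_sim]
      refine Set.union_empty_iff.2 ⟨?_, Set.eq_empty_of_forall_notMem ?_⟩
      · simp [hc]
      · rintro m ⟨⟨-, h1, h2⟩, -⟩
        simp [h1, h2] at h
    have hdone : (.sim b o.isSome c.state : ChainState N.Q) ∉ N.chain.accept := by rintro ⟨⟩
    match o with
    | some ρ =>
      -- The current path has turned out to be equal to the previous one and is rejected.
      obtain rfl := eq_nil_of_mem_accRuns hc (hR _ rfl).1
      have : {τ ∈ N.accRuns c | Above (some []) τ} = ∅ :=
        Set.eq_empty_of_forall_notMem fun τ hτ => by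
          obtain rfl := eq_nil_of_mem_accRuns hc hτ.1
          exact lt_irrefl _ (hτ.2 _ rfl)
      rw [this, finsum_mem_empty]
      exact Counts.halt_reject (hmoves (.inl rfl)) hdone _
    | none =>
      by_cases hacc : c.state ∈ N.accept
      · have : {τ ∈ N.accRuns c | Above none τ} = {[]} :=
          Set.eq_singleton_iff_unique_mem.2 ⟨⟨nil_mem_accRuns.2 ⟨hc, hacc⟩, by simp [Above]⟩,
            fun τ hτ => eq_nil_of_mem_accRuns hc hτ.1⟩
        rw [this, finsum_mem_singleton]
        exact (hG [] (nil_mem_accRuns.2 ⟨hc, hacc⟩) (by simp [Above]) R).mono (by omega)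
      · have : {τ ∈ N.accRuns c | Above none τ} = ∅ :=
          Set.eq_empty_of_forall_notMem fun τ hτ => by
            obtain rfl := eq_nil_of_mem_accRuns hc hτ.1
            exact hacc hτ.1.2.2
        rw [this, finsum_mem_empty]
        exact Counts.halt_reject (hmoves (.inr hacc)) hdone _
  · have hlen : ∀ m ∈ N.moves c, ∀ ms, N.IsRun (N.next c m) ms → ms.length + 1 ≤ t :=
      fun m hm ms hms => ht (m :: ms) ⟨hm, hms⟩
    cases t with
    | zero =>
      obtain ⟨m, hm⟩ := hc
      exact absurd (hlen m hm [] trivial) (by simp)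
    | succ t =>
      have hU := accRuns_above_eq_iUnion hc fun ρ hρ => (hR ρ hρ).1
      have hmoves := moves_sim_of_remembers (b := b) (L := L) hc hR
      have hne : (allowed c o).Nonempty := by
        match o with
        | none => exact hc.mono fun m hm => ⟨hm, by simp⟩
        | some [] => exact absurd (nil_mem_accRuns.1 (hR _ rfl).1).1 hc.ne_empty
        | some (m₀ :: ρ) => exact ⟨m₀, (cons_mem_accRuns.1 (hR _ rfl).1).1, by simp⟩
      rw [hU, finsum_mem_iUnion_cons
        (Set.toFinite _) fun m hm => (finite_accRuns fun ms hms =>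
          Nat.le_of_succ_le_succ (hlen m hm.1 ms hms)).subset (Set.sep_subset _ _)]
      refine Counts.step_image (T := T + t) (recordMove_injective b _ _) hne hmoves fun m hm => ?_
      refine next_recordMove b _ _ c L R m ▸ ih t (Nat.lt_succ_self t)
        (fun ms hms => Nat.le_of_succ_le_succ (hlen m hm.1 ms hms)) (hR.tail m)
        fun τ hτ hτo R' => ?_
      have hmem : m :: τ ∈ {τ ∈ N.accRuns c | Above o τ} := by
        rw [hU]
        exact Set.mem_biUnion hm ⟨τ, ⟨hτ, hτo⟩, rfl⟩
      have := hG (m :: τ) hmem.1 hmem.2 R'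
      rwa [records, List.reverse_cons, ListBlank.append_assoc] at this

/-- The end of a round: the sequence of paths either stops here, provided that its length is odd,
or the initial configuration is recovered and a larger path is guessed. -/
theorem Counts.turn {b : Bool} {n T : ℕ} {c : N.Cfg} {τ : List (TMMove N.Q N.Γ N.K)}
    {R : ListBlank N.ChainSym} (hc : c.state = N.start) (hτ : τ ∈ N.accRuns c)
    (h : N.chain.Counts (chainCfg (.sim (!b) true c.state) c.tape
      (.mk' (ListBlank.mk []) (ListBlank.append (records c τ) R))) n T) :
    N.chain.Counts (chainCfg (.sim b false (N.final c τ).state) (N.final c τ).tape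
      (.mk' (ListBlank.append (records c τ).reverse (ListBlank.mk [])) R))
      (n + if b then 0 else 1) (T + 2 * τ.length + 2) := by
  have hback : N.chain.Counts (chainCfg (.unmove !b) c.tape ((Tape.mk' (ListBlank.mk [])
      (ListBlank.append (records c τ) R)).move .left)) n (T + 1) := by
    refine Counts.step_singleton (moves_unmove_of_blank ?_) ?_
    · rw [Tape.move_left_mk', Tape.mk'_head, ListBlank.head_cons]
      rfl
    · rw [next_histMove, Tape.move_left_right, ← hc]
      exact h
  have hcont := hback.undo
  set H := Tape.mk' (ListBlank.append (records c τ).reverse (ListBlank.mk [])) R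
  set c' := N.final c τ with hc'
  have hmoves : N.chain.moves (chainCfg (.sim b false c'.state) c'.tape H) =
      {m | m = histMove (chainScanned c'.tape H) (.unmove !b) (some .left) ∨
        b = false ∧ m = histMove (chainScanned c'.tape H) .done none} := by
    rw [moves_sim]
    simp only [hc', hτ.2.1, hτ.2.2]
    simp
    rfl
  have hback' : N.chain.Counts (N.chain.next (chainCfg (.sim b false c'.state) c'.tape H)
      (histMove (chainScanned c'.tape H) (.unmove !b) (some .left))) n
      (T + 2 * τ.length + 1) := by
    rw [next_histMove]
    exact hcont.mono (by omega)
  cases b with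
  | true => exact Counts.step_singleton (hmoves.trans (by simp; rfl)) hback'
  | false =>
    refine Counts.step_pair (m' := histMove (chainScanned c'.tape H) .done none) ?_
      (hmoves.trans (by simp; rfl)) hback' (Counts.halt_accept ?_ ?_ _)
    · intro h
      cases congrArg TMMove.state h
    · rfl
    · exact Set.mem_singleton _

end NTM

/-! ### All rounds -/

/-- The number of subsets of odd cardinality (for `b = false`), or of nonempty subsets of even
cardinality (for `b = true`), of a set with `j` elements. The recursion splits off the smallest
element, which either is not chosen, or is chosen first and followed by a nonempty subset or by
nothing. -/
def chainCount : Bool → ℕ → ℕ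
  | _, 0 => 0
  | b, j + 1 => chainCount b j + (chainCount (!b) j + if b then 0 else 1)

theorem sum_range_chainCount (b : Bool) (j : ℕ) :
    ∑ i ∈ Finset.range j, (chainCount (!b) i + if b then 0 else 1) = chainCount b j := by
  induction j with
  | zero => cases b <;> rfl
  | succ j ih => rw [Finset.sum_range_succ, ih, chainCount]

theorem chainCount_succ (j : ℕ) :
    chainCount false (j + 1) = 2 ^ j ∧ chainCount true (j + 1) + 1 = 2 ^ j := by
  induction j with
  | zero => simp [chainCount]
  | succ j ih =>
    obtain ⟨h1, h2⟩ := ih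
    rw [chainCount, chainCount.eq_def true (j + 1 + 1)]
    simp only [Bool.not_false, Bool.not_true, pow_succ, Bool.false_eq_true, if_false, if_true]
    omega

namespace NTM

variable {N : NTM}

theorem ncard_above_lt {S U : Set (List (TMMove N.Q N.Γ N.K))}
    {o : Option (List (TMMove N.Q N.Γ N.K))} (hS : S.Finite) (hU : U = {τ ∈ S | Above o τ})
    {τ : List (TMMove N.Q N.Γ N.K)} (hτ : τ ∈ U) :
    {τ' ∈ S | Above (some τ) τ'} = {τ' ∈ U | τ < τ'} ∧
      {τ' ∈ S | Above (some τ) τ'}.ncard < U.ncard := by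
  have h : {τ' ∈ S | Above (some τ) τ'} = {τ' ∈ U | τ < τ'} := by
    subst hU
    ext τ'
    constructor
    · rintro ⟨h1, h2⟩
      exact ⟨⟨h1, fun ρ hρ => (hτ.2 ρ hρ).trans (h2 τ rfl)⟩, h2 τ rfl⟩
    · rintro ⟨⟨h1, -⟩, h2⟩
      exact ⟨h1, by simpa [Above] using h2⟩
  refine ⟨h, Set.ncard_lt_ncard ?_ (hS.subset (hU ▸ Set.sep_subset _ _))⟩
  rw [h]
  exact ⟨Set.sep_subset _ _, fun hsub => lt_irrefl τ (hsub hτ).2⟩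

/-- All remaining rounds of the chain machine, when `j` accepting paths of `N` exceed the previous
one. Each of the at most `j + 1` rounds takes at most `P` steps for the simulation, two steps for
undoing each of them, and two more steps. -/
theorem counts_chain {c : N.Cfg} {P : ℕ} (hc : c.state = N.start)
    (hP : ∀ ms, N.IsRun c ms → ms.length ≤ P) (j : ℕ) {b : Bool}
    {o : Option (List (TMMove N.Q N.Γ N.K))} {R : ListBlank N.ChainSym} (hR : Remembers c o R)
    (hj : {τ ∈ N.accRuns c | Above o τ}.ncard = j) :
    N.chain.Counts (chainCfg (.sim b o.isSome c.state) c.tape (.mk' (ListBlank.mk []) R))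
      (chainCount b j) ((j + 1) * (3 * P + 2)) := by
  induction j using Nat.strong_induction_on generalizing b o R with | _ j ih => ?_
  have hS := finite_accRuns hP
  set U := {τ ∈ N.accRuns c | Above o τ} with hU
  have hUfin : U.Finite := hS.subset (Set.sep_subset _ _)
  have hround := Counts.sim (b := b) (L := ListBlank.mk [])
    (G := fun τ =>
      chainCount (!b) {τ' ∈ N.accRuns c | Above (some τ) τ'}.ncard + if b then 0 else 1)
    (T := j * (3 * P + 2) + 2 * P + 2) hP hR fun τ hτ hτo R' => by
      have hlt := (ncard_above_lt hS hU (τ := τ) ⟨hτ, hτo⟩).2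
      rw [hj] at hlt
      refine (Counts.turn hc hτ (ih _ hlt (o := some τ) ?_ rfl)).mono ?_
      · rintro _ ⟨⟩
        exact ⟨hτ, R', rfl⟩
      · have h1 := Nat.mul_le_mul_right (3 * P + 2) (Nat.succ_le_of_lt hlt)
        have h2 := hP τ hτ.1
        simp only [Nat.succ_eq_add_one] at h1
        omega
  have hsum : ∑ᶠ τ ∈ U, (chainCount (!b) {τ' ∈ N.accRuns c | Above (some τ) τ'}.ncard +
      if b then 0 else 1) = chainCount b j := by
    rw [finsum_mem_eq_finite_toFinset_sum _ hUfin, ← sum_range_chainCount, ← hj,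
      Set.ncard_eq_toFinset_card U hUfin, ← Finset.sum_card_filter_lt]
    refine Finset.sum_congr rfl fun τ hτ => ?_
    rw [(ncard_above_lt hS hU (hUfin.mem_toFinset.1 hτ)).1, ← Set.ncard_coe_finset]
    simp
  rw [← hU, hsum] at hround
  exact hround.mono (by rw [add_mul]; omega)

theorem counts_chain_init {x : List Bool} {P : ℕ}
    (hP : ∀ ms, N.IsRun (N.init x) ms → ms.length ≤ P) :
    N.chain.Counts (N.chain.init x) (chainCount false (N.accRuns (N.init x)).ncard)
      (((N.accRuns (N.init x)).ncard + 1) * (3 * P + 2)) := by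
  rw [init_chain]
  have := counts_chain (c := N.init x) (b := false) (o := none) (R := ListBlank.mk []) rfl hP _
    (by simp [Remembers]) rfl
  have h : {τ ∈ N.accRuns (N.init x) | Above none τ} = N.accRuns (N.init x) := by simp [Above]
  rw [h] at this
  exact this

theorem Counts.numAcc_eq {x : List Bool} {n T : ℕ} (h : N.Counts (N.init x) n T) :
    N.numAcc x = n := by
  rw [← h.1, (finite_accRuns h.2).cast_ncard_eq]
  rfl

end NTM

theorem corollary2p7 : FewP ⊆ EP := by
  rintro L ⟨N, ⟨p, hp⟩, q, hq⟩
  have hfin : ∀ x, (N.accRuns (N.init x)).Finite := fun x => NTM.finite_accRuns (hp x)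
  have hacc : ∀ x, N.numAcc x = (N.accRuns (N.init x)).ncard := fun x =>
    (hfin x).cast_ncard_eq.symm
  have hcount := fun x => NTM.counts_chain_init (hp x)
  refine ⟨N.chain, ⟨(q + 1) * (3 * p + 2), fun x ms hms => ((hcount x).2 ms hms).trans ?_⟩,
    fun x => ⟨fun hx => ?_, fun hx => ?_⟩⟩
  · have hle : (N.accRuns (N.init x)).ncard ≤ q.eval x.length := by
      by_cases hx : x ∈ L
      · have := ((hq x).2 hx).2
        rw [hacc] at this
        exact_mod_cast this
      · have := (hq x).1 hx
        rw [hacc] at this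
        norm_cast at this
        omega
    simpa using Nat.mul_le_mul_right (3 * p.eval x.length + 2) (Nat.succ_le_succ hle)
  · have := (hq x).1 hx
    rw [hacc] at this
    norm_cast at this
    rw [(hcount x).numAcc_eq, this]
    rfl
  · have := ((hq x).2 hx).1
    rw [hacc] at this
    norm_cast at this
    obtain ⟨i, hi⟩ := Nat.exists_eq_add_of_le' this
    exact ⟨i, by rw [(hcount x).numAcc_eq, hi, (chainCount_succ i).1]⟩
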